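/- Let $\mathbb F_q$ be a finite field with $q$ elements. For a linear code $C\subseteq\mathbb F_q^n$ of dimension $k$ and minimum distance $d$ (the least Hamming distance between distinct codewords), a set $R\subseteq\{1,\dots,n\}$ containing $i$ is a repair group of the $i$-th symbol if there are coefficients $a_j\in\mathbb F_q$ with $c_i=\sum_{j\in R\setminus\{i\}}a_jc_j$ for all $c\in C$. The code $C$ is an LRC with locality $r$ if every symbol has a repair group of size at most $r+1$. It has disjoint local repair groups if $\{1,\dots,n\}$ is a disjoint union of sets of size $r+1$, each of which is exactly the support of a word of the dual code $C^\perp$. Such a code (so $(r+1)\mid n$) is called Singleton-optimal if $$n-k=\frac{n}{r+1}+d-2-\left\lfloor\frac{d-2}{r+1}\right\rfloor .$$ (For $d=7$, $r=2$ this means $k=\frac{2n}{3}-4$, equivalently $d=n-k-\lceil k/r\rceil+1$.) Theorem. For every prime power $q\ge 4$ and $n=3\left\lceil\frac{7+\sqrt{72q^2+121}}{18}\right\rceil$, there exists a Singleton-optimal LRC over $\mathbb F_q$ with disjoint local repair groups, of length $n$, minimum distance $7$ and locality $2$. These lengths satisfy $n\approx\sqrt2\,q$, i.e. $n/q\to\sqrt2$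 as $q\to\infty$. -/

import Mathlib

open Filter Topology

/-- `d` is the minimum distance of the linear code `C` of length `n` over `F`: the least Hamming
distance between two distinct codewords. The zero code has no minimum distance. -/
def IsMinDistance {F : Type*} [Field F] [DecidableEq F] {n : ℕ}
    (C : Submodule F (Fin n → F)) (d : ℕ) : Prop :=
  IsLeast {w : ℕ | ∃ x ∈ C, ∃ y ∈ C, x ≠ y ∧ hammingDist x y = w} d

/-- `R` is a repair group of the `i`-th symbol of `C`: `i ∈ R`, and the `i`-th symbol of every
codeword is one fixed linear combination of the other symbols at positions in `R`. -/
def IsRepairGroup {F : Type*} [Field F] {n : ℕ}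
    (C : Submodule F (Fin n → F)) (i : Fin n) (R : Finset (Fin n)) : Prop :=
  i ∈ R ∧ ∃ a : Fin n → F, ∀ c ∈ C, c i = ∑ j ∈ R.erase i, a j * c j

/-- `C` is a locally repairable code with locality `r`: each symbol has a repair group of size at
most `r + 1`. -/
def HasLocality {F : Type*} [Field F] {n : ℕ}
    (C : Submodule F (Fin n → F)) (r : ℕ) : Prop :=
  ∀ i : Fin n, ∃ R : Finset (Fin n), R.card ≤ r + 1 ∧ IsRepairGroup C i R

/-- `C` has disjoint local repair groups: the coordinate set is partitioned into sets of size
`r + 1`, each of which is the support of a word of the dual code (a locality vector). In particular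
each part is a repair group of every symbol in it. -/
def HasDisjointRepairGroups {F : Type*} [Field F] {n : ℕ}
    (C : Submodule F (Fin n → F)) (r : ℕ) : Prop :=
  ∃ P : Finpartition (Finset.univ : Finset (Fin n)),
    ∀ R ∈ P.parts, R.card = r + 1 ∧
      ∃ h : Fin n → F, (∀ c ∈ C, h ⬝ᵥ c = 0) ∧ ∀ j, h j ≠ 0 ↔ j ∈ R

/-- `C` is a Singleton-optimal locally repairable code of length `n`, minimum distance `d` and
locality `r`, with disjoint local repair groups. With `k = dim C`, optimality is the equality
`n - k = n / (r + 1) + d - 2 - ⌊(d - 2) / (r + 1)⌋` (division on `ℤ` rounds down here). -/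
structure IsSingletonOptimalLRC {F : Type*} [Field F] [DecidableEq F] {n : ℕ}
    (C : Submodule F (Fin n → F)) (d r : ℕ) : Prop where
  minDistance : IsMinDistance C d
  locality : HasLocality C r
  disjointRepairGroups : HasDisjointRepairGroups C r
  dvd_length : r + 1 ∣ n
  optimal : (n : ℤ) - (Module.finrank F C : ℤ) =
    (n : ℤ) / (r + 1) + d - 2 - ((d : ℤ) - 2) / (r + 1)

/-- The length `3⌈(7 + √(72q² + 121)) / 18⌉`. -/
noncomputable def lrcLength (q : ℕ) : ℕ :=
  3 * ⌈(7 + Real.sqrt (72 * (q : ℝ) ^ 2 + 121)) / 18⌉₊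

/-!
Let `q = |F|` and let `V` be a four-dimensional vector space over `F`. A code of length `3 m` is
built from `m` pairwise disjoint planes of `V` (lines of `PG(3, q)`), each with a basis
`a i, b i`: besides one check per repair group `{0, 1, 2} × {i}` there is one `V`-valued check, with
columns `0, a i, b i` in the `i`-th group. A nonzero word on a group whose coordinates sum to zero
contributes a nonzero vector of the plane to the global check. It has weight `2` exactly when this
vector is a multiple of `a i`, `b i` or `a i - b i`, the three marked points of the line, and
weight `3` otherwise. Since the planes are disjoint, every nonzero codeword meets at least three
groups, so its weight is at least `7` unless it consists of three marked vectors summing to zero.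
Hence the minimum distance is at least `7` as soon as no three marked points on different lines
are collinear (`IsMarkedFamily.seven_le_hammingNorm`), and the dimension is `3 m - (m + 4)`
because two of the planes span `V`.

Such families are grown greedily inside a spread of `q² + 1` planes partitioning `V`
(`IsMarkedFamily.exists_extend`). A secant through two marked points on different lines of the
family has at most `q - 1` points outside the family, and there are `9 (m choose 2)` secants. A
line of the spread on which fewer than three points avoid all secants contains at least `q - 1`
points of secants. So a new line can be added whenever `9 (m choose 2) < q² + 1 - m`, and solving
this quadratic inequality gives exactly the length `3 ⌈(7 + √(72 q² + 121)) / 18⌉`.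

The minimum distance must not exceed `7` either; the parameters alone do not exclude distance `8`.
The greedy process therefore starts from three planes that already carry a codeword of weight at
most `2 + 2 + 3`: a marked point of the first line and one of the second are collinear with an
(unmarked) point of the third (`exists_isMarkedFamily_three`). Here `q ≥ 4` is used. The spread is
the set of one-dimensional subspaces of `K²`, where `K` is the quadratic extension of `F`.
-/

/-! ### Marked vectors and the greedy extension of a family of marked planes -/

/-- The vectors marked by a pair `a, b`: the nonzero multiples of `a`, of `b` and of `a - b`.
Projectively, these are three points of the line spanned by `a` and `b`. -/
def IsMarked (F : Type*) {V : Type*} [Field F] [AddCommGroup V] [Module F V] (a b v : V) : Prop :=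
  ∃ c : F, c ≠ 0 ∧ (v = c • a ∨ v = c • b ∨ v = c • (a - b))

/-- A family of `m` distinct members `S (u 0), …, S (u (m - 1))` of `S`, each with two independent
vectors `a i, b i`, such that no three marked vectors from three different members sum to zero.
The values of `u`, `a`, `b` at arguments `≥ m` are irrelevant. -/
structure IsMarkedFamily {F V ι : Type*} [Field F] [AddCommGroup V] [Module F V]
    (S : ι → Submodule F V) (m : ℕ) (u : ℕ → ι) (a b : ℕ → V) : Prop where
  inj : ∀ i < m, ∀ j < m, u i = u j → i = j
  left_mem : ∀ i < m, a i ∈ S (u i)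
  right_mem : ∀ i < m, b i ∈ S (u i)
  indep : ∀ i < m, LinearIndependent F ![a i, b i]
  no_three : ∀ i j k, i < j → j < k → k < m → ∀ x y z, IsMarked F (a i) (b i) x →
    IsMarked F (a j) (b j) y → IsMarked F (a k) (b k) z → x + y + z ≠ 0

section Marked

variable {F V : Type*} [Field F] [AddCommGroup V] [Module F V]

theorem IsMarked.smul {a b v : V} (h : IsMarked F a b v) {c : F} (hc : c ≠ 0) :
    IsMarked F a b (c • v) := by
  obtain ⟨d, hd, h⟩ := h
  refine ⟨c * d, mul_ne_zero hc hd, ?_⟩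
  rcases h with rfl | rfl | rfl <;> simp [mul_smul]

theorem IsMarked.ne_zero {a b v : V} (h : IsMarked F a b v)
    (hab : LinearIndependent F ![a, b]) : v ≠ 0 := by
  rw [LinearIndependent.pair_iff] at hab
  obtain ⟨c, hc, h⟩ := h
  rintro rfl
  rcases h with h | h | h
  · exact hc (hab c 0 (by simp [← h])).1
  · exact hc (hab 0 c (by simp [← h])).2
  · exact hc (hab c (-c) (by rw [neg_smul, ← sub_eq_add_neg, ← smul_sub, ← h])).1

open Classical in
/-- The nonzero multiples of a vector. -/
noncomputable def nonzeroMultiples (F : Type*) {V : Type*} [Field F] [AddCommGroup V] [Module F V]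
    [Fintype F] (w : V) : Finset V :=
  (Finset.univ.erase (0 : F)).image (· • w)

theorem mem_nonzeroMultiples [Fintype F] {w v : V} :
    v ∈ nonzeroMultiples F w ↔ ∃ c : F, c ≠ 0 ∧ c • w = v := by
  simp [nonzeroMultiples]

theorem card_nonzeroMultiples_le [Fintype F] (w : V) :
    (nonzeroMultiples F w).card ≤ Fintype.card F - 1 := by
  classical
  refine Finset.card_image_le.trans ?_
  rw [Finset.card_erase_of_mem (Finset.mem_univ _), Finset.card_univ]

open Classical in
/-- The finite set of vectors marked by `a, b`. -/
noncomputable def markedFinset (F : Type*) {V : Type*} [Field F] [AddCommGroup V] [Module F V]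
    [Fintype F] (a b : V) : Finset V :=
  nonzeroMultiples F a ∪ nonzeroMultiples F b ∪ nonzeroMultiples F (a - b)

theorem mem_markedFinset [Fintype F] {a b v : V} :
    v ∈ markedFinset F a b ↔ IsMarked F a b v := by
  simp only [markedFinset, Finset.mem_union, mem_nonzeroMultiples, IsMarked, eq_comm (a := v),
    and_or_left, exists_or, or_assoc]

theorem card_markedFinset_le [Fintype F] (a b : V) :
    (markedFinset F a b).card ≤ 3 * (Fintype.card F - 1) := by
  classical
  have h1 := card_nonzeroMultiples_le (F := F) a
  have h2 := card_nonzeroMultiples_le (F := F) b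
  have h3 := card_nonzeroMultiples_le (F := F) (a - b)
  have h4 := Finset.card_union_le (nonzeroMultiples F a ∪ nonzeroMultiples F b)
    (nonzeroMultiples F (a - b))
  have h5 := Finset.card_union_le (nonzeroMultiples F a) (nonzeroMultiples F b)
  rw [markedFinset]
  omega

open Classical Pointwise in
/-- The sums of two marked vectors from different members of the family `(a i, b i)`, `i < m`.
Projectively, these are the points, other than the end points, of the secants through two marked
points on different lines. -/
noncomputable def secantFinset (F : Type*) {V : Type*} [Field F] [AddCommGroup V] [Module F V]
    [Fintype F] (m : ℕ) (a b : ℕ → V) : Finset V :=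
  (Finset.range m).biUnion fun j => (Finset.range j).biUnion fun i =>
    markedFinset F (a i) (b i) + markedFinset F (a j) (b j)

theorem mem_secantFinset [Fintype F] {m : ℕ} {a b : ℕ → V} {v : V} :
    v ∈ secantFinset F m a b ↔ ∃ j < m, ∃ i < j, ∃ x, IsMarked F (a i) (b i) x ∧
      ∃ y, IsMarked F (a j) (b j) y ∧ x + y = v := by
  simp only [secantFinset, Finset.mem_biUnion, Finset.mem_range, Finset.mem_add, mem_markedFinset]

theorem smul_mem_secantFinset [Fintype F] {m : ℕ} {a b : ℕ → V} {v : V}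
    (h : v ∈ secantFinset F m a b) {c : F} (hc : c ≠ 0) : c • v ∈ secantFinset F m a b := by
  rw [mem_secantFinset] at *
  obtain ⟨j, hj, i, hi, x, hx, y, hy, rfl⟩ := h
  exact ⟨j, hj, i, hi, c • x, hx.smul hc, c • y, hy.smul hc, (smul_add _ _ _).symm⟩

theorem card_secantFinset_le [Fintype F] (m : ℕ) (a b : ℕ → V) :
    (secantFinset F m a b).card ≤ 9 * (m * (m - 1) / 2) * (Fintype.card F - 1) ^ 2 := by
  classical
  have h : ∀ i j, ((markedFinset F (a i) (b i)).card * (markedFinset F (a j) (b j)).card) ≤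
      9 * (Fintype.card F - 1) ^ 2 := fun i j =>
    (Nat.mul_le_mul (card_markedFinset_le _ _) (card_markedFinset_le _ _)).trans (by ring_nf; rfl)
  unfold secantFinset
  calc _ ≤ ∑ j ∈ Finset.range m, ∑ i ∈ Finset.range j, 9 * (Fintype.card F - 1) ^ 2 := by
        refine Finset.card_biUnion_le.trans (Finset.sum_le_sum fun j _ => ?_)
        refine Finset.card_biUnion_le.trans (Finset.sum_le_sum fun i _ => ?_)
        exact Finset.card_add_le.trans (h i j)
    _ = _ := by
        simp only [Finset.sum_const, Finset.card_range, smul_eq_mul]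
        rw [← Finset.sum_mul, Finset.sum_range_id]
        ring

theorem span_pair_eq {U : Submodule F V} (hU : Module.finrank F U = 2) {a b : V} (ha : a ∈ U)
    (hb : b ∈ U) (hab : LinearIndependent F ![a, b]) : Submodule.span F {a, b} = U := by
  have := Module.finite_of_finrank_pos (R := F) (M := U) (by omega)
  apply Submodule.eq_of_le_of_finrank_eq
  · rw [Submodule.span_le]
    rintro v (rfl | rfl)
    exacts [ha, hb]
  · rw [hU]
    have h := finrank_span_eq_card hab
    rw [Matrix.range_cons_cons_empty] at h
    exact h

open Classical in
/-- If a scaling-invariant set `B` leaves more than `2 (q - 1)` nonzero vectors of a plane free,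
then the free vectors occupy at least three projective points of it, and these can be taken as the
marked ones. -/
theorem exists_marked_avoiding [Fintype F] [Fintype V] {U : Submodule F V}
    (hU : Module.finrank F U = 2) (B : Finset V)
    (hB : ∀ v ∈ B, ∀ c : F, c ≠ 0 → c • v ∈ B)
    (hcard : (B.filter fun v => v ∈ U ∧ v ≠ 0).card < (Fintype.card F - 1) ^ 2) :
    ∃ a ∈ U, ∃ b ∈ U, LinearIndependent F ![a, b] ∧ ∀ v, IsMarked F a b v → v ∉ B := by
  have hq : 1 < Fintype.card F := Fintype.one_lt_card
  set free : Finset V := Finset.univ.filter fun v => (v ∈ U ∧ v ≠ 0) ∧ v ∉ B with hfree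
  have hB' : ∀ v ∉ B, ∀ c : F, c ≠ 0 → c • v ∉ B := fun v hv c hc h =>
    hv (by simpa [smul_smul, inv_mul_cancel₀ hc] using hB _ h c⁻¹ (inv_ne_zero hc))
  have hUcard : (Finset.univ.filter fun v : V => v ∈ U ∧ v ≠ 0).card = Fintype.card F ^ 2 - 1 := by
    have h1 : Fintype.card U = Fintype.card F ^ 2 := by
      rw [Module.card_eq_pow_finrank (K := F), hU]
    have h2 : (Finset.univ.filter fun v : V => v ∈ U ∧ v ≠ 0) =
        (Finset.univ.filter fun v : V => v ∈ U).erase 0 := by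
      ext v; simp [and_comm]
    rw [h2, Finset.card_erase_of_mem (by simp), ← Fintype.card_subtype, ← h1]
  have hfreecard : 2 * (Fintype.card F - 1) < free.card := by
    have h1 : free.card + (B.filter fun v => v ∈ U ∧ v ≠ 0).card = Fintype.card F ^ 2 - 1 := by
      rw [← hUcard, ← Finset.card_filter_add_card_filter_not (fun v => v ∉ B)
        (s := Finset.univ.filter fun v : V => v ∈ U ∧ v ≠ 0), Finset.filter_filter,
        Finset.filter_filter]
      congr 2
      ext v; simp; tauto
    obtain ⟨k, hk⟩ := Nat.exists_eq_add_of_lt hq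
    rw [hk] at h1 hcard ⊢
    have : (1 + k + 1) ^ 2 - 1 = (k + 1) ^ 2 + 2 * (k + 1) := by
      rw [Nat.sub_eq_iff_eq_add (Nat.one_le_pow _ _ (by omega))]; ring
    have h3 : 1 + k + 1 - 1 = k + 1 := by omega
    rw [h3] at hcard ⊢
    omega
  have hex : ∀ T : Finset V, T.card ≤ 2 * (Fintype.card F - 1) → ∃ v ∈ free, v ∉ T := fun T hT => by
    by_contra! h
    exact absurd (Finset.card_le_card (s := free) (t := T) h) (by omega)
  obtain ⟨w₁, hw₁, -⟩ := hex ∅ (by simp)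
  obtain ⟨w₂, hw₂, hw₂'⟩ := hex (nonzeroMultiples F w₁)
    ((card_nonzeroMultiples_le w₁).trans (by omega))
  obtain ⟨w₃, hw₃, hw₃'⟩ := hex (nonzeroMultiples F w₁ ∪ nonzeroMultiples F w₂)
    ((Finset.card_union_le _ _).trans (by
      have := card_nonzeroMultiples_le (F := F) w₁
      have := card_nonzeroMultiples_le (F := F) w₂
      omega))
  simp only [hfree, Finset.mem_filter, Finset.mem_univ, true_and] at hw₁ hw₂ hw₃
  simp only [Finset.mem_union, mem_nonzeroMultiples, not_or, not_exists, not_and] at hw₂' hw₃'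
  have hind : LinearIndependent F ![w₁, w₂] := by
    rw [LinearIndependent.pair_iff' hw₁.1.2]
    intro c hc
    refine hw₂' c ?_ hc
    rintro rfl
    exact hw₂.1.2 (by simp [← hc])
  have hspan := span_pair_eq hU hw₁.1.1 hw₂.1.1 hind
  obtain ⟨c, d, hcd⟩ := Submodule.mem_span_pair.1 (hspan.symm ▸ hw₃.1.1)
  have hc : c ≠ 0 := by
    rintro rfl
    refine hw₃'.2 d ?_ (by simpa using hcd)
    rintro rfl
    exact hw₃.1.2 (by simp [← hcd])
  have hd : d ≠ 0 := by
    rintro rfl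
    exact hw₃'.1 c hc (by simpa using hcd)
  -- Rescaling `w₁` and `w₂` turns `w₃ = c w₁ + d w₂` into the difference of the two generators.
  refine ⟨c • w₁, U.smul_mem _ hw₁.1.1, (-d) • w₂, U.smul_mem _ hw₂.1.1, ?_, ?_⟩
  · rw [LinearIndependent.pair_iff] at hind ⊢
    intro s t hst
    have := hind (s * c) (t * -d) (by rw [mul_smul, mul_smul, hst])
    simpa [hc, hd] using this
  · rintro v ⟨e, he, rfl | rfl | rfl⟩
    · rw [smul_smul]
      exact hB' _ hw₁.2 _ (mul_ne_zero he hc)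
    · rw [smul_smul]
      exact hB' _ hw₂.2 _ (mul_ne_zero he (neg_ne_zero.2 hd))
    · rw [neg_smul, sub_neg_eq_add, hcd]
      exact hB' _ hw₃.2 _ he

/-- The greedy step. The secants of the family have at most `9 (m choose 2) (q - 1)` points outside
it, while a member of the spread in which fewer than three points are free has at least `q - 1`
points on secants, so some member outside the family has three free points. -/
theorem IsMarkedFamily.exists_extend [Fintype F] [Fintype V] {ι : Type*} [Fintype ι]
    {S : ι → Submodule F V} (hS : Pairwise fun s t => Disjoint (S s) (S t))
    (hfin : ∀ s, Module.finrank F (S s) = 2) (hι : Fintype.card ι = Fintype.card F ^ 2 + 1)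
    {m : ℕ} {u : ℕ → ι} {a b : ℕ → V} (h : IsMarkedFamily S m u a b)
    (hm : 9 * (m * (m - 1) / 2) + m < Fintype.card F ^ 2 + 1) :
    ∃ s a' b', IsMarkedFamily S (m + 1) (Function.update u m s) (Function.update a m a')
      (Function.update b m b') := by
  classical
  have hq : 1 < Fintype.card F := Fintype.one_lt_card
  set B := secantFinset F m a b with hBdef
  obtain ⟨s, hs, hsB⟩ : ∃ s ∉ (Finset.range m).image u,
      (B.filter fun v => v ∈ S s ∧ v ≠ 0).card < (Fintype.card F - 1) ^ 2 := by
    by_contra! hcon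
    set T := Finset.univ \ (Finset.range m).image u with hT
    have hTcard : Fintype.card F ^ 2 + 1 - m ≤ T.card := by
      rw [hT, ← hι]
      have h1 := Finset.le_card_sdiff ((Finset.range m).image u) Finset.univ
      have h2 : ((Finset.range m).image u).card ≤ m := by
        simpa using Finset.card_image_le (s := Finset.range m) (f := u)
      rw [Finset.card_univ] at h1
      omega
    have hdisj : (T : Set ι).PairwiseDisjoint fun s => B.filter fun v => v ∈ S s ∧ v ≠ 0 := by
      intro s _ t _ hst
      rw [Function.onFun, Finset.disjoint_left]
      intro v hv hv'
      simp only [Finset.mem_filter] at hv hv'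
      exact hv.2.2 ((Submodule.disjoint_def.1 (hS hst)) v hv.2.1 hv'.2.1)
    have h1 : T.card * (Fintype.card F - 1) ^ 2 ≤ B.card := by
      calc _ ≤ ∑ s ∈ T, (B.filter fun v => v ∈ S s ∧ v ≠ 0).card := by
            rw [← smul_eq_mul, ← Finset.sum_const]
            exact Finset.sum_le_sum fun s hs => hcon s (by simpa [hT] using hs)
        _ = (T.biUnion fun s => B.filter fun v => v ∈ S s ∧ v ≠ 0).card :=
            (Finset.card_biUnion hdisj).symm
        _ ≤ B.card := Finset.card_le_card (Finset.biUnion_subset.2 fun s _ =>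
            Finset.filter_subset _ _)
    have h2 := Nat.le_of_mul_le_mul_right (h1.trans (card_secantFinset_le m a b))
      (pow_pos (by omega) 2)
    omega
  obtain ⟨a', ha', b', hb', hind, hav⟩ := exists_marked_avoiding (hfin s) B
    (fun v hv c hc => smul_mem_secantFinset hv hc) hsB
  have hs' : ∀ i < m, u i ≠ s := fun i hi he =>
    hs (Finset.mem_image.2 ⟨i, Finset.mem_range.2 hi, he⟩)
  refine ⟨s, a', b', ?_, ?_, ?_, ?_, ?_⟩
  · intro i hi j hj hij
    rcases Nat.lt_succ_iff_lt_or_eq.1 hi with hi | rfl <;>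
      rcases Nat.lt_succ_iff_lt_or_eq.1 hj with hj | rfl
    · rw [Function.update_of_ne hi.ne, Function.update_of_ne hj.ne] at hij
      exact h.inj i hi j hj hij
    · rw [Function.update_of_ne hi.ne, Function.update_self] at hij
      exact absurd hij (hs' i hi)
    · rw [Function.update_of_ne hj.ne, Function.update_self] at hij
      exact absurd hij.symm (hs' j hj)
    · rfl
  · intro i hi
    rcases Nat.lt_succ_iff_lt_or_eq.1 hi with hi | rfl
    · simpa only [Function.update_of_ne hi.ne] using h.left_mem i hi
    · simpa using ha'
  · intro i hi
    rcases Nat.lt_succ_iff_lt_or_eq.1 hi with hi | rfl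
    · simpa only [Function.update_of_ne hi.ne] using h.right_mem i hi
    · simpa using hb'
  · intro i hi
    rcases Nat.lt_succ_iff_lt_or_eq.1 hi with hi | rfl
    · simpa only [Function.update_of_ne hi.ne] using h.indep i hi
    · simpa using hind
  · intro i j k hij hjk hk x y z hx hy hz hxyz
    rw [Function.update_of_ne (by omega), Function.update_of_ne (by omega)] at hx hy
    rcases Nat.lt_succ_iff_lt_or_eq.1 hk with hk | rfl
    · rw [Function.update_of_ne hk.ne, Function.update_of_ne hk.ne] at hz
      exact h.no_three i j k hij hjk hk x y z hx hy hz hxyz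
    · rw [Function.update_self, Function.update_self] at hz
      refine hav _ (hz.smul (neg_ne_zero.2 one_ne_zero)) ?_
      rw [hBdef, mem_secantFinset]
      exact ⟨j, hjk, i, hij, x, hx, y, hy, by
        rw [neg_smul, one_smul]; exact eq_neg_of_add_eq_zero_left hxyz⟩

end Marked

/-! ### The Desarguesian spread and an initial family of three planes -/

section Spread

variable (F K : Type*) [Field F] [Field K] [Algebra F K]

/-- Representatives of the points of the projective line over `K`; `none` is the point at
infinity. -/
def projRep {K : Type*} [Field K] : Option K → K × K
  | none => (0, 1)
  | some t => (1, t)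

/-- The Desarguesian spread: the one-dimensional `K`-subspaces of `K × K`, viewed over the
subfield `F`. -/
def spread (u : Option K) : Submodule F (K × K) :=
  LinearMap.range ((LinearMap.toSpanSingleton K (K × K) (projRep u)).restrictScalars F)

variable {F K}

theorem mem_spread {u : Option K} {v : K × K} : v ∈ spread F K u ↔ ∃ x : K, x • projRep u = v :=
  Iff.rfl

theorem smul_mem_spread (u : Option K) (x : K) : x • projRep u ∈ spread F K u :=
  mem_spread.2 ⟨x, rfl⟩

theorem projRep_ne_zero (u : Option K) : projRep u ≠ 0 := by
  cases u <;> simp [projRep, Prod.ext_iff]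

theorem finrank_spread (u : Option K) :
    Module.finrank F (spread F K u) = Module.finrank F K := by
  refine LinearMap.finrank_range_of_inj fun x y hxy => ?_
  exact smul_left_injective K (projRep_ne_zero u) hxy

theorem pairwise_disjoint_spread :
    Pairwise fun s t : Option K => Disjoint (spread F K s) (spread F K t) := by
  intro s t hst
  rw [Submodule.disjoint_def]
  intro v hs ht
  obtain ⟨x, rfl⟩ := mem_spread.1 hs
  obtain ⟨y, hy⟩ := mem_spread.1 ht
  have h1 := congrArg Prod.fst hy
  have h2 := congrArg Prod.snd hy
  rcases s with _ | s <;> rcases t with _ | t <;> simp [projRep] at h1 h2 hst ⊢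
  · subst h1; simpa using h2.symm
  · exact ⟨h1.symm, Or.inl h1.symm⟩
  · subst h1
    have := (mul_eq_mul_left_iff.1 h2).resolve_left fun h => hst h.symm
    exact ⟨this, Or.inl this⟩

theorem exists_linearIndependent_one (h : Module.finrank F K = 2) :
    ∃ ω : K, LinearIndependent F ![1, ω] := by
  by_contra! hcon
  have : Module.finrank F K ≤ 1 := by
    refine finrank_le_one (1 : K) fun w => ?_
    by_contra! hw
    exact hcon w ((LinearIndependent.pair_iff' one_ne_zero).2 hw)
  omega

/-- Vectors marked in a common member of the spread are given by elements of `K` marked by the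
coordinates. -/
theorem IsMarked.exists_smul {α β : K} {p v : K × K} (h : IsMarked F (α • p) (β • p) v) :
    ∃ x : K, IsMarked F α β x ∧ v = x • p := by
  obtain ⟨c, hc, rfl | rfl | rfl⟩ := h
  · exact ⟨c • α, ⟨c, hc, Or.inl rfl⟩, by rw [smul_assoc]⟩
  · exact ⟨c • β, ⟨c, hc, Or.inr (Or.inl rfl)⟩, by rw [smul_assoc]⟩
  · exact ⟨c • (α - β), ⟨c, hc, Or.inr (Or.inr rfl)⟩, by rw [smul_assoc, sub_smul]⟩

theorem LinearIndependent.pair_smul {α β : K} (h : LinearIndependent F ![α, β]) {p : K × K}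
    (hp : p ≠ 0) : LinearIndependent F ![α • p, β • p] := by
  rw [LinearIndependent.pair_iff] at h ⊢
  intro s t hst
  refine h s t ?_
  rw [← smul_assoc, ← smul_assoc, ← add_smul] at hst
  exact (smul_eq_zero.1 hst).resolve_right hp

theorem LinearIndependent.pair_combination {ω : K} (h : LinearIndependent F ![1, ω])
    {s t s' t' : F} (hdet : s * t' ≠ t * s') :
    LinearIndependent F ![s • 1 + t • ω, s' • 1 + t' • ω] :=
  (LinearIndependent.pair_add_smul_add_smul_iff (x := (1 : K)) (y := ω) s t s' t').2 ⟨h, hdet⟩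

/-- The three marked directions in coordinates with respect to `1, ω`. -/
theorem IsMarked.exists_coords {ω : K} {s t s' t' : F} {w : K}
    (h : IsMarked F (s • 1 + t • ω) (s' • 1 + t' • ω) w) :
    ∃ c x y : F, c ≠ 0 ∧ w = x • 1 + y • ω ∧ ((x = c * s ∧ y = c * t) ∨ (x = c * s' ∧ y = c * t') ∨
      (x = c * (s - s') ∧ y = c * (t - t'))) := by
  obtain ⟨c, hc, rfl | rfl | rfl⟩ := h
  · exact ⟨c, _, _, hc, by module, Or.inl ⟨rfl, rfl⟩⟩
  · exact ⟨c, _, _, hc, by module, Or.inr (Or.inl ⟨rfl, rfl⟩)⟩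
  · exact ⟨c, _, _, hc, by module, Or.inr (Or.inr ⟨rfl, rfl⟩)⟩

/-- The nonzero vectors of `F²` on the three lines through `(1, 0)`, `(0, 1)`, `(1, -1)`, those on
the lines through `(1, 0)`, `(0, k)`, `(1, -k)` and those on the lines through `(1, -1)`,
`(μ, -μ k)`, `(1 - μ, μ k - 1)` have nothing in common up to sign. -/
theorem no_common_projective_point {k μ c d e x₁ x₂ y₁ y₂ z₁ z₂ : F} (hk0 : k ≠ 0) (hk1 : k ≠ 1)
    (hμ0 : μ ≠ 0) (hμ1 : μ ≠ 1) (hμk : μ * k ≠ 1) (hc : c ≠ 0) (hd : d ≠ 0) (he : e ≠ 0)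
    (hx : (x₁ = c * 1 ∧ x₂ = c * 0) ∨ (x₁ = c * 0 ∧ x₂ = c * 1) ∨
      (x₁ = c * (1 - 0) ∧ x₂ = c * (0 - 1)))
    (hy : (y₁ = d * 1 ∧ y₂ = d * 0) ∨ (y₁ = d * 0 ∧ y₂ = d * k) ∨
      (y₁ = d * (1 - 0) ∧ y₂ = d * (0 - k)))
    (hz : (z₁ = e * 1 ∧ z₂ = e * -1) ∨ (z₁ = e * μ ∧ z₂ = e * -(μ * k)) ∨
      (z₁ = e * (1 - μ) ∧ z₂ = e * (-1 - -(μ * k))))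
    (h1 : x₁ + z₁ = 0) (h2 : x₂ + z₂ = 0) (h3 : y₁ + z₁ = 0) (h4 : y₂ + z₂ = 0) : False := by
  have hz1 : z₁ ≠ 0 := by
    rcases hz with ⟨rfl, -⟩ | ⟨rfl, -⟩ | ⟨rfl, -⟩
    · simpa using he
    · exact mul_ne_zero he hμ0
    · exact mul_ne_zero he (sub_ne_zero.2 hμ1.symm)
  have hz2 : z₂ ≠ 0 := by
    rcases hz with ⟨-, rfl⟩ | ⟨-, rfl⟩ | ⟨-, rfl⟩
    · simpa using he
    · exact mul_ne_zero he (neg_ne_zero.2 (mul_ne_zero hμ0 hk0))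
    · exact mul_ne_zero he fun h => hμk (by linear_combination h)
  rcases hx with ⟨-, rfl⟩ | ⟨rfl, -⟩ | ⟨rfl, rfl⟩
  · exact hz2 (by simpa using h2)
  · exact hz1 (by simpa using h1)
  rcases hy with ⟨-, rfl⟩ | ⟨rfl, -⟩ | ⟨rfl, rfl⟩
  · exact hz2 (by simpa using h4)
  · exact hz1 (by simpa using h3)
  obtain rfl : c = d := by linear_combination h1 - h3
  exact hk1 (mul_left_cancel₀ hc (by linear_combination h2 - h4))

/-- Three members of the spread with marked vectors, no three of which sum to zero, but such that
two marked vectors in the first two planes have their sum in the third plane. Identify each of the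
three planes with `K`; then three vectors sum to zero only if they agree up to sign. So it suffices
to have three triples of projective points over `F` without a common point, the first two of them
overlapping: these are `{1, ω, 1 - ω}`, `{1, ω, 1 - k ω}` and a triple avoiding `1` and `ω`. -/
theorem exists_isMarkedFamily_three [Fintype F] (hq : 4 ≤ Fintype.card F)
    (hK : Module.finrank F K = 2) :
    ∃ (u : ℕ → Option K) (a b : ℕ → K × K), IsMarkedFamily (spread F K) 3 u a b ∧
      ∃ x y, IsMarked F (a 0) (b 0) x ∧ IsMarked F (a 1) (b 1) y ∧ x + y ∈ spread F K (u 2) := by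
  classical
  obtain ⟨ω, hω⟩ := exists_linearIndependent_one hK
  have hcard : ∀ T : Finset F, T.card ≤ 3 → ∃ c, c ∉ T := fun T hT => by
    by_contra! h
    have := Finset.card_le_card (s := Finset.univ) (t := T) fun c _ => h c
    rw [Finset.card_univ] at this
    omega
  -- `k` makes the first two triples differ in their third point; `μ` keeps the difference of the
  -- third pair of generators off the points `1` and `ω`. It has to avoid three elements of `F`.
  obtain ⟨k, hk⟩ := hcard {0, 1} (Finset.card_le_two.trans (by omega))
  obtain ⟨μ, hμ⟩ := hcard {0, 1, k⁻¹} Finset.card_le_three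
  simp only [Finset.mem_insert, Finset.mem_singleton, not_or] at hk hμ
  obtain ⟨hk0, hk1⟩ := hk
  obtain ⟨hμ0, hμ1, hμk⟩ := hμ
  have hμk' : μ * k ≠ 1 := fun h => hμk (eq_inv_of_mul_eq_one_left h)
  let u : ℕ → Option K := fun | 0 => some 0 | 1 => none | _ => some 1
  let α : ℕ → K := fun
    | 0 => (1 : F) • 1 + (0 : F) • ω
    | 1 => (1 : F) • 1 + (0 : F) • ω
    | _ => (1 : F) • 1 + (-1 : F) • ω
  let β : ℕ → K := fun
    | 0 => (0 : F) • 1 + (1 : F) • ω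
    | 1 => (0 : F) • 1 + k • ω
    | _ => μ • 1 + (-(μ * k)) • ω
  refine ⟨u, fun i => α i • projRep (u i), fun i => β i • projRep (u i),
    ⟨?_, ?_, ?_, ?_, ?_⟩, (1, 0), (0, 1), ?_, ?_, ?_⟩
  · intro i hi j hj
    interval_cases i <;> interval_cases j <;> simp [u]
  · exact fun i _ => smul_mem_spread _ _
  · exact fun i _ => smul_mem_spread _ _
  · intro i hi
    refine LinearIndependent.pair_smul ?_ (projRep_ne_zero _)
    interval_cases i
    · change LinearIndependent F ![(1 : F) • 1 + (0 : F) • ω, (0 : F) • 1 + (1 : F) • ω]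
      exact hω.pair_combination (by simp)
    · change LinearIndependent F ![(1 : F) • 1 + (0 : F) • ω, (0 : F) • 1 + k • ω]
      exact hω.pair_combination (by simpa using hk0)
    · change LinearIndependent F ![(1 : F) • 1 + (-1 : F) • ω, μ • 1 + (-(μ * k)) • ω]
      refine hω.pair_combination fun h => ?_
      have : μ * (1 - k) = 0 := by linear_combination h
      rcases mul_eq_zero.1 this with h | h
      exacts [hμ0 h, hk1 (sub_eq_zero.1 h).symm]
  · intro i j l hij hjl hl x y z hx hy hz hxyz
    obtain rfl : i = 0 := by omega
    obtain rfl : j = 1 := by omega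
    obtain rfl : l = 2 := by omega
    obtain ⟨x, hx', rfl⟩ := hx.exists_smul
    obtain ⟨y, hy', rfl⟩ := hy.exists_smul
    obtain ⟨z, hz', rfl⟩ := hz.exists_smul
    have h1 : x + z = 0 := by simpa [u, projRep] using congrArg Prod.fst hxyz
    have h2 : y + z = 0 := by simpa [u, projRep] using congrArg Prod.snd hxyz
    obtain ⟨c, x₁, x₂, hc, rfl, hx''⟩ := hx'.exists_coords
    obtain ⟨d, y₁, y₂, hd, rfl, hy''⟩ := hy'.exists_coords
    obtain ⟨e, z₁, z₂, he, rfl, hz''⟩ := hz'.exists_coords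
    rw [LinearIndependent.pair_iff] at hω
    obtain ⟨h1, h3⟩ := hω (x₁ + z₁) (x₂ + z₂) (by rw [← h1]; module)
    obtain ⟨h2, h4⟩ := hω (y₁ + z₁) (y₂ + z₂) (by rw [← h2]; module)
    exact no_common_projective_point hk0 hk1 hμ0 hμ1 hμk' hc hd he hx'' hy'' hz'' h1 h3 h2 h4
  · exact ⟨1, one_ne_zero, Or.inl (by simp [α, u, projRep])⟩
  · exact ⟨1, one_ne_zero, Or.inl (by simp [α, u, projRep])⟩
  · exact mem_spread.2 ⟨1, by simp [u, projRep]⟩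

end Spread

/-! ### The code of a family of marked planes -/

section Code

variable {F V : Type*} [Field F] [AddCommGroup V] [Module F V]

/-- The `i`-th local repair group: the coordinates of `Fin (3 * m)` correspond to `Fin 3 × Fin m`,
and the group consists of the three coordinates with second component `i`. -/
def repairGroup {m : ℕ} (i : Fin m) : Finset (Fin (3 * m)) :=
  Finset.univ.map ⟨fun j : Fin 3 => finProdFinEquiv (j, i), fun j k h => by simpa using h⟩

theorem mem_repairGroup {m : ℕ} {i : Fin m} {n : Fin (3 * m)} :
    n ∈ repairGroup i ↔ (finProdFinEquiv.symm n).2 = i := by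
  rw [repairGroup, Finset.mem_map]
  constructor
  · rintro ⟨j, -, rfl⟩
    exact congrArg Prod.snd (finProdFinEquiv.symm_apply_apply (j, i))
  · rintro rfl
    exact ⟨(finProdFinEquiv.symm n).1, Finset.mem_univ _, finProdFinEquiv.apply_symm_apply n⟩

theorem card_repairGroup {m : ℕ} (i : Fin m) : (repairGroup i).card = 3 := by
  simp [repairGroup]

theorem sum_repairGroup {M : Type*} [AddCommMonoid M] {m : ℕ} (i : Fin m) (c : Fin (3 * m) → M) :
    ∑ n ∈ repairGroup i, c n = ∑ j, c (finProdFinEquiv (j, i)) :=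
  Finset.sum_map _ _ _

/-- The vector that a word contributes to the global parity check in its `i`-th group. -/
def groupVector (a b : ℕ → V) {m : ℕ} (c : Fin (3 * m) → F) (i : Fin m) : V :=
  c (finProdFinEquiv (1, i)) • a i + c (finProdFinEquiv (2, i)) • b i

/-- The parity check map: its components are the sum over each repair group, and one global check
with values in `V`, in which the `i`-th group has the columns `0, a i, b i`. -/
def parityCheck (m : ℕ) (a b : ℕ → V) : (Fin (3 * m) → F) →ₗ[F] (Fin m → F) × V where
  toFun c := (fun i => ∑ j, c (finProdFinEquiv (j, i)), ∑ i, groupVector a b c i)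
  map_add' c d := by
    simp only [groupVector, Pi.add_apply, Finset.sum_add_distrib, add_smul, Prod.mk_add_mk,
      Prod.mk.injEq]
    exact ⟨rfl, by abel⟩
  map_smul' r c := by
    simp only [groupVector, Pi.smul_apply, smul_eq_mul, ← Finset.mul_sum, mul_smul, ← smul_add,
      ← Finset.smul_sum]
    rfl

/-- The code with parity check map `parityCheck m a b`. -/
def markedCode (F : Type*) {V : Type*} [Field F] [AddCommGroup V] [Module F V] (m : ℕ)
    (a b : ℕ → V) : Submodule F (Fin (3 * m) → F) :=
  LinearMap.ker (parityCheck m a b)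

theorem mem_markedCode {m : ℕ} {a b : ℕ → V} {c : Fin (3 * m) → F} :
    c ∈ markedCode F m a b ↔ (∀ i : Fin m, ∑ j, c (finProdFinEquiv (j, i)) = 0) ∧
      ∑ i, groupVector a b c i = 0 := by
  simp [markedCode, parityCheck, Prod.ext_iff, funext_iff]

theorem sum_repairGroup_eq_zero {m : ℕ} {a b : ℕ → V} {c : Fin (3 * m) → F}
    (hc : c ∈ markedCode F m a b) (i : Fin m) : ∑ n ∈ repairGroup i, c n = 0 := by
  rw [sum_repairGroup]
  exact (mem_markedCode.1 hc).1 i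

theorem hasLocality_markedCode (m : ℕ) (a b : ℕ → V) : HasLocality (markedCode F m a b) 2 := by
  intro n
  have hn : n ∈ repairGroup (finProdFinEquiv.symm n).2 := mem_repairGroup.2 rfl
  refine ⟨_, (card_repairGroup _).le, hn, fun _ => -1, fun c hc => ?_⟩
  have h := sum_repairGroup_eq_zero hc (finProdFinEquiv.symm n).2
  rw [← Finset.add_sum_erase _ _ hn] at h
  rw [← Finset.mul_sum, neg_one_mul]
  exact eq_neg_of_add_eq_zero_left h

theorem hasDisjointRepairGroups_markedCode (m : ℕ) (a b : ℕ → V) :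
    HasDisjointRepairGroups (markedCode F m a b) 2 := by
  classical
  refine ⟨⟨Finset.univ.image (repairGroup (m := m)), ?_, ?_, ?_⟩, ?_⟩
  · rw [Finset.supIndep_iff_pairwiseDisjoint]
    intro R hR R' hR' hne
    obtain ⟨i, -, rfl⟩ := Finset.mem_image.1 hR
    obtain ⟨i', -, rfl⟩ := Finset.mem_image.1 hR'
    rw [Function.onFun, id, id, Finset.disjoint_left]
    intro n hn hn'
    exact hne (by rw [← mem_repairGroup.1 hn, ← mem_repairGroup.1 hn'])
  · ext n
    simp only [Finset.mem_sup, Finset.mem_image, Finset.mem_univ, true_and, iff_true]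
    exact ⟨_, ⟨(finProdFinEquiv.symm n).2, rfl⟩, mem_repairGroup.2 rfl⟩
  · intro h
    obtain ⟨i, -, hi⟩ := Finset.mem_image.1 h
    have := card_repairGroup i
    rw [hi] at this
    simp at this
  · intro R hR
    obtain ⟨i, -, rfl⟩ := Finset.mem_image.1 hR
    refine ⟨card_repairGroup i, fun n => if n ∈ repairGroup i then 1 else 0, fun c hc => ?_, ?_⟩
    · simp only [dotProduct, ite_mul, one_mul, zero_mul, Finset.sum_ite_mem, Finset.univ_inter]
      exact sum_repairGroup_eq_zero hc i
    · simp

/-! ### Dimension -/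

/-- A word is given by its values on the groups. -/
def ofGroups {α : Type*} {m : ℕ} (g : ℕ → Fin 3 → α) (n : Fin (3 * m)) : α :=
  g (finProdFinEquiv.symm n).2 (finProdFinEquiv.symm n).1

theorem ofGroups_apply {α : Type*} {m : ℕ} (g : ℕ → Fin 3 → α) (j : Fin 3) (i : Fin m) :
    ofGroups g (finProdFinEquiv (j, i)) = g i j := by
  simp [ofGroups]

theorem sum_fin_eq_of_forall_le {M : Type*} [AddCommMonoid M] {k m : ℕ} (hkm : k ≤ m) (f : ℕ → M)
    (hf : ∀ i, k ≤ i → f i = 0) : ∑ i : Fin m, f i = ∑ i ∈ Finset.range k, f i := by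
  rw [Fin.sum_univ_eq_sum_range]
  refine (Finset.sum_subset (Finset.range_mono hkm) fun i _ hi => hf i ?_).symm
  simpa using hi

variable {ι : Type*} {S : ι → Submodule F V} {m : ℕ} {u : ℕ → ι} {a b : ℕ → V}

/-- Two disjoint planes span `V`, so already the first two groups make the global check
surjective. -/
theorem IsMarkedFamily.parityCheck_surjective
    (hS : Pairwise fun s t => Disjoint (S s) (S t)) (hfin : ∀ s, Module.finrank F (S s) = 2)
    (hV : Module.finrank F V = 4) (h : IsMarkedFamily S m u a b) (hm : 2 ≤ m) :
    Function.Surjective (parityCheck (F := F) m a b) := by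
  have := Module.finite_of_finrank_pos (R := F) (M := V) (by omega)
  rintro ⟨s, v⟩
  have hne : u 0 ≠ u 1 := fun he => by simpa using h.inj 0 (by omega) 1 (by omega) he
  have htop : S (u 0) ⊔ S (u 1) = ⊤ := by
    apply Submodule.eq_top_of_disjoint _ _ _ (hS hne)
    rw [hfin, hfin, hV]
  have hspan : ∀ i < m, Submodule.span F {a i, b i} = S (u i) := fun i hi =>
    span_pair_eq (hfin _) (h.left_mem i hi) (h.right_mem i hi) (h.indep i hi)
  obtain ⟨x, hx, y, hy, hxy⟩ := Submodule.mem_sup.1 (htop ▸ Submodule.mem_top (x := v))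
  rw [← hspan 0 (by omega)] at hx
  rw [← hspan 1 (by omega)] at hy
  obtain ⟨p₀, q₀, rfl⟩ := Submodule.mem_span_pair.1 hx
  obtain ⟨p₁, q₁, rfl⟩ := Submodule.mem_span_pair.1 hy
  let p : ℕ → F := fun | 0 => p₀ | 1 => p₁ | _ => 0
  let q : ℕ → F := fun | 0 => q₀ | 1 => q₁ | _ => 0
  let s' : ℕ → F := fun i => if hi : i < m then s ⟨i, hi⟩ else 0
  refine ⟨ofGroups fun i => ![s' i - p i - q i, p i, q i], Prod.ext (funext fun i => ?_) ?_⟩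
  · simp [parityCheck, Fin.sum_univ_three, ofGroups_apply, s']
    ring
  · simp only [parityCheck, groupVector, LinearMap.coe_mk, AddHom.coe_mk, ofGroups_apply]
    refine (sum_fin_eq_of_forall_le hm (fun i => p i • a i + q i • b i) ?_).trans ?_
    · intro i hi
      obtain ⟨i, rfl⟩ := Nat.exists_eq_add_of_le' hi
      simp [p, q]
    · simpa [Finset.sum_range_succ, p, q] using hxy

theorem IsMarkedFamily.finrank_markedCode
    (hS : Pairwise fun s t => Disjoint (S s) (S t)) (hfin : ∀ s, Module.finrank F (S s) = 2)
    (hV : Module.finrank F V = 4) (h : IsMarkedFamily S m u a b) (hm : 2 ≤ m) :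
    Module.finrank F (markedCode F m a b) + (m + 4) = 3 * m := by
  have := Module.finite_of_finrank_pos (R := F) (M := V) (by omega)
  have h1 := LinearMap.finrank_range_add_finrank_ker (parityCheck (F := F) m a b)
  rw [LinearMap.range_eq_top.2 (h.parityCheck_surjective hS hfin hV hm), finrank_top,
    Module.finrank_prod, Module.finrank_pi, hV, Module.finrank_pi, Fintype.card_fin,
    Fintype.card_fin] at h1
  rw [markedCode]
  omega

/-! ### Minimum distance -/

section Triple

variable [DecidableEq F]

/-- The weight of a triple, that is, of a word restricted to a repair group. -/
def tripleWeight (f : Fin 3 → F) : ℕ := hammingNorm f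

theorem tripleWeight_eq (f : Fin 3 → F) : tripleWeight f =
    (if f 0 ≠ 0 then 1 else 0) + (if f 1 ≠ 0 then 1 else 0) + (if f 2 ≠ 0 then 1 else 0) := by
  rw [tripleWeight, hammingNorm, Finset.card_filter, Fin.sum_univ_three]

theorem hammingNorm_eq_sum_tripleWeight {m : ℕ} (c : Fin (3 * m) → F) :
    hammingNorm c = ∑ i, tripleWeight fun j => c (finProdFinEquiv (j, i)) := by
  simp only [tripleWeight, hammingNorm, Finset.card_filter]
  rw [← Equiv.sum_comp finProdFinEquiv, Fintype.sum_prod_type_right]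

theorem two_le_tripleWeight {f : Fin 3 → F} (hf : ∑ j, f j = 0) (h : f 1 ≠ 0 ∨ f 2 ≠ 0) :
    2 ≤ tripleWeight f := by
  rw [Fin.sum_univ_three] at hf
  rw [tripleWeight_eq]
  by_cases h0 : f 0 = 0 <;> by_cases h1 : f 1 = 0 <;> by_cases h2 : f 2 = 0 <;> simp_all

/-- Words of weight two on a group contribute marked vectors: with coefficients `f 1 = 0`, `f 2 = 0`
and `f 0 = 0` these are multiples of `b`, of `a` and of `a - b`. -/
theorem isMarked_of_tripleWeight_le_two {f : Fin 3 → F} (hf : ∑ j, f j = 0)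
    (h : f 1 ≠ 0 ∨ f 2 ≠ 0) (hw : tripleWeight f ≤ 2) (a b : V) :
    IsMarked F a b (f 1 • a + f 2 • b) := by
  rw [Fin.sum_univ_three] at hf
  rw [tripleWeight_eq] at hw
  by_cases h1 : f 1 = 0
  · exact ⟨f 2, by tauto, by simp [h1]⟩
  by_cases h2 : f 2 = 0
  · exact ⟨f 1, h1, by simp [h2]⟩
  have h0 : f 0 = 0 := by
    by_contra h0
    simp [h0, h1, h2] at hw
  have h3 : f 2 = -f 1 := by linear_combination hf - h0
  exact ⟨f 1, h1, Or.inr (Or.inr (by rw [h3]; module))⟩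

theorem IsMarked.exists_triple {a b v : V} (h : IsMarked F a b v) :
    ∃ f : Fin 3 → F, ∑ j, f j = 0 ∧ f 1 • a + f 2 • b = v ∧ tripleWeight f ≤ 2 := by
  simp only [tripleWeight_eq, Fin.sum_univ_three]
  obtain ⟨c, hc, rfl | rfl | rfl⟩ := h
  · exact ⟨![-c, c, 0], by simp, by simp, by simp [hc]⟩
  · exact ⟨![-c, 0, c], by simp, by simp, by simp [hc]⟩
  · exact ⟨![0, c, -c], by simp, by simp [sub_eq_add_neg], by simp [hc]⟩

end Triple

theorem IsMarkedFamily.no_three_of_ne (h : IsMarkedFamily S m u a b) {i j k : ℕ} (hij : i ≠ j)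
    (hik : i ≠ k) (hjk : j ≠ k) (hi : i < m) (hj : j < m) (hk : k < m) {x y z : V}
    (hx : IsMarked F (a i) (b i) x) (hy : IsMarked F (a j) (b j) y)
    (hz : IsMarked F (a k) (b k) z) : x + y + z ≠ 0 := by
  have h' := h.no_three
  rcases hij.lt_or_gt with h1 | h1 <;> rcases hik.lt_or_gt with h2 | h2 <;>
    rcases hjk.lt_or_gt with h3 | h3
  · exact h' i j k h1 h3 hk x y z hx hy hz
  · exact fun he => h' i k j h2 h3 hj x z y hx hz hy (by rw [← he]; abel)
  · omega
  · exact fun he => h' k i j h2 h1 hj z x y hz hx hy (by rw [← he]; abel)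
  · exact fun he => h' j i k h1 h2 hk y x z hy hx hz (by rw [← he]; abel)
  · omega
  · exact fun he => h' j k i h3 h2 hi y z x hy hz hx (by rw [← he]; abel)
  · exact fun he => h' k j i h3 h1 hi z y x hz hy hx (by rw [← he]; abel)

/-- The nonzero group vectors of a codeword sum to zero. As the planes are disjoint, there are at
least three of them. If there are at least four, the weight is at least `8`; if there are three,
they are not all marked, so that some group has weight `3`. -/
theorem IsMarkedFamily.seven_le_hammingNorm [DecidableEq F]
    (hS : Pairwise fun s t => Disjoint (S s) (S t)) (h : IsMarkedFamily S m u a b)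
    {c : Fin (3 * m) → F} (hc : c ∈ markedCode F m a b) (hc0 : c ≠ 0) : 7 ≤ hammingNorm c := by
  classical
  obtain ⟨hloc, hglob⟩ := mem_markedCode.1 hc
  set v : Fin m → V := groupVector a b c with hv
  set T := Finset.univ.filter fun i => v i ≠ 0 with hT
  set w : Fin m → ℕ := fun i => tripleWeight fun j => c (finProdFinEquiv (j, i)) with hw
  have hvS : ∀ i : Fin m, v i ∈ S (u i) := fun i => (S (u i)).add_mem
    ((S (u i)).smul_mem _ (h.left_mem i i.2)) ((S (u i)).smul_mem _ (h.right_mem i i.2))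
  have hcoef : ∀ i, v i ≠ 0 → c (finProdFinEquiv (1, i)) ≠ 0 ∨ c (finProdFinEquiv (2, i)) ≠ 0 := by
    intro i hi
    by_contra! h0
    exact hi (by simp [hv, groupVector, h0.1, h0.2])
  have hw2 : ∀ i ∈ T, 2 ≤ w i := fun i hi =>
    two_le_tripleWeight (hloc i) (hcoef i (Finset.mem_filter.1 hi).2)
  have hmark : ∀ i ∈ T, w i ≤ 2 → IsMarked F (a i) (b i) (v i) := fun i hi hwi =>
    isMarked_of_tripleWeight_le_two (hloc i) (hcoef i (Finset.mem_filter.1 hi).2) hwi _ _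
  have hsumT : ∑ i ∈ T, v i = 0 := by
    rw [hT, Finset.sum_filter_ne_zero, hglob]
  have hnorm : ∑ i ∈ T, w i ≤ hammingNorm c := by
    rw [hammingNorm_eq_sum_tripleWeight]
    exact Finset.sum_le_sum_of_subset (Finset.subset_univ _)
  have hT2 : T.card * 2 ≤ ∑ i ∈ T, w i := by
    rw [← smul_eq_mul, ← Finset.sum_const]
    exact Finset.sum_le_sum hw2
  have hne : ∀ i ∈ T, v i ≠ 0 := fun i hi => (Finset.mem_filter.1 hi).2
  by_cases h4 : 4 ≤ T.card
  · omega
  have h3 : T.card = 0 ∨ T.card = 1 ∨ T.card = 2 ∨ T.card = 3 := by omega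
  rcases h3 with h3 | h3 | h3 | h3
  · exfalso
    apply hc0
    rw [Finset.card_eq_zero, Finset.filter_eq_empty_iff] at h3
    have hz : ∀ j i, c (finProdFinEquiv (j, i)) = 0 := by
      intro j i
      have h1 := not_not.1 (h3 (Finset.mem_univ i))
      have h2 := LinearIndependent.pair_iff.1 (h.indep i i.2) _ _ h1
      have h0 := hloc i
      rw [Fin.sum_univ_three, h2.1, h2.2, add_zero, add_zero] at h0
      fin_cases j
      exacts [h0, h2.1, h2.2]
    funext n
    obtain ⟨⟨j, i⟩, rfl⟩ := finProdFinEquiv.surjective n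
    exact hz j i
  · obtain ⟨i, hi⟩ := Finset.card_eq_one.1 h3
    rw [hi, Finset.sum_singleton] at hsumT
    exact absurd hsumT (hne i (by simp [hi]))
  · obtain ⟨i, j, hij, hTij⟩ := Finset.card_eq_two.1 h3
    rw [hTij, Finset.sum_pair hij] at hsumT
    have hu : u (i : ℕ) ≠ u (j : ℕ) := fun he => hij (Fin.ext (h.inj i i.2 j j.2 he))
    refine absurd (Submodule.disjoint_def.1 (hS hu) (v i) (hvS i) ?_) (hne i (by simp [hTij]))
    rw [eq_neg_of_add_eq_zero_left hsumT]
    exact (S (u j)).neg_mem (hvS j)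
  · obtain ⟨i, j, k, hij, hik, hjk, hTijk⟩ := Finset.card_eq_three.1 h3
    by_contra! hlt
    have hi : i ∈ T := by simp [hTijk]
    have hj : j ∈ T := by simp [hTijk]
    have hk : k ∈ T := by simp [hTijk]
    have hs3 : ∑ l ∈ T, w l = w i + w j + w k := by
      rw [hTijk, Finset.sum_insert (by simp [hij, hik]), Finset.sum_pair hjk, add_assoc]
    have := hw2 i hi
    have := hw2 j hj
    have := hw2 k hk
    refine h.no_three_of_ne (fun he => hij (Fin.ext he)) (fun he => hik (Fin.ext he))
      (fun he => hjk (Fin.ext he)) i.2 j.2 k.2 (hmark i hi (by omega)) (hmark j hj (by omega))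
      (hmark k hk (by omega)) ?_
    rw [← hsumT, hTijk, Finset.sum_insert (by simp [hij, hik]), Finset.sum_pair hjk, add_assoc]

/-- Two marked vectors in the first two planes with sum in the third plane give a codeword of
weight at most `2 + 2 + 3`. -/
theorem IsMarkedFamily.exists_hammingNorm_le_seven [DecidableEq F]
    (hfin : ∀ s, Module.finrank F (S s) = 2) (h : IsMarkedFamily S m u a b) (hm : 3 ≤ m)
    {x y : V} (hx : IsMarked F (a 0) (b 0) x) (hy : IsMarked F (a 1) (b 1) y)
    (hxy : x + y ∈ S (u 2)) : ∃ c ∈ markedCode F m a b, c ≠ 0 ∧ hammingNorm c ≤ 7 := by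
  have hx0 : x ≠ 0 := hx.ne_zero (h.indep 0 (by omega))
  obtain ⟨f₀, hf₀, hf₀x, hf₀w⟩ := hx.exists_triple
  obtain ⟨f₁, hf₁, hf₁y, hf₁w⟩ := hy.exists_triple
  rw [← span_pair_eq (hfin (u 2)) (h.left_mem 2 (by omega)) (h.right_mem 2 (by omega))
    (h.indep 2 (by omega)), Submodule.mem_span_pair] at hxy
  obtain ⟨p, q, hpq⟩ := hxy
  let g : ℕ → Fin 3 → F := fun | 0 => f₀ | 1 => f₁ | 2 => ![p + q, -p, -q] | _ => 0
  have hg : ∀ i, 3 ≤ i → g i = 0 := by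
    intro i hi
    obtain ⟨i, rfl⟩ := Nat.exists_eq_add_of_le' hi
    rfl
  have hw3 : ∀ f : Fin 3 → F, tripleWeight f ≤ 3 := fun f => by
    simpa [tripleWeight] using hammingNorm_le_card_fintype (x := f)
  refine ⟨ofGroups g, mem_markedCode.2 ⟨fun i => ?_, ?_⟩, ?_, ?_⟩
  · simp only [ofGroups_apply]
    obtain ⟨i, hi⟩ := i
    rcases i with _ | _ | _ | i
    · exact hf₀
    · exact hf₁
    · simp [g, Fin.sum_univ_three]
    · simp [g]
  · simp only [groupVector, ofGroups_apply]
    refine (sum_fin_eq_of_forall_le hm (fun i => g i 1 • a i + g i 2 • b i) ?_).trans ?_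
    · intro i hi
      simp [hg i hi]
    · simp only [Finset.sum_range_succ, Finset.sum_range_zero, zero_add, g, hf₀x, hf₁y, ← hpq]
      simp only [Matrix.cons_val]
      module
  · intro h0
    apply hx0
    have h1 := fun j => congrFun h0 (finProdFinEquiv (j, (⟨0, by omega⟩ : Fin m)))
    simp only [ofGroups_apply, Pi.zero_apply] at h1
    rw [← hf₀x, show f₀ 1 = 0 from h1 1, show f₀ 2 = 0 from h1 2]
    simp
  · rw [hammingNorm_eq_sum_tripleWeight]
    simp only [ofGroups_apply]
    refine (sum_fin_eq_of_forall_le hm (fun i => tripleWeight (g i)) ?_).trans_le ?_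
    · intro i hi
      simp [hg i hi, tripleWeight]
    · simp only [Finset.sum_range_succ, Finset.sum_range_zero, zero_add, g]
      have := hw3 ![p + q, -p, -q]
      omega

theorem IsMarkedFamily.isSingletonOptimalLRC [DecidableEq F]
    (hS : Pairwise fun s t => Disjoint (S s) (S t)) (hfin : ∀ s, Module.finrank F (S s) = 2)
    (hV : Module.finrank F V = 4) (h : IsMarkedFamily S m u a b) (hm : 3 ≤ m)
    {x y : V} (hx : IsMarked F (a 0) (b 0) x) (hy : IsMarked F (a 1) (b 1) y)
    (hxy : x + y ∈ S (u 2)) : IsSingletonOptimalLRC (markedCode F m a b) 7 2 where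
  minDistance := by
    constructor
    · obtain ⟨c, hc, hc0, hc7⟩ := h.exists_hammingNorm_le_seven hfin hm hx hy hxy
      exact ⟨c, hc, 0, Submodule.zero_mem _, hc0, by
        rw [hammingDist_zero_right]
        exact le_antisymm hc7 (h.seven_le_hammingNorm hS hc hc0)⟩
    · rintro w ⟨c, hc, d, hd, hcd, rfl⟩
      rw [hammingDist_eq_hammingNorm]
      refine h.seven_le_hammingNorm hS (Submodule.add_mem _ (Submodule.neg_mem _ hc) hd) ?_
      rwa [neg_add_eq_sub, sub_ne_zero, ne_comm]
  locality := hasLocality_markedCode m a b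
  disjointRepairGroups := hasDisjointRepairGroups_markedCode m a b
  dvd_length := ⟨m, rfl⟩
  optimal := by
    have := h.finrank_markedCode hS hfin hV (by omega)
    push_cast
    omega

end Code

/-! ### The length of the code -/

/-- Below the ceiling defining the length, the counting inequality of the greedy step holds. -/
theorem greedy_bound_of_lt_ceil {q m : ℕ}
    (hm : m < ⌈(7 + Real.sqrt (72 * (q : ℝ) ^ 2 + 121)) / 18⌉₊) :
    9 * (m * (m - 1) / 2) + m < q ^ 2 + 1 := by
  rcases Nat.eq_zero_or_pos m with rfl | hm0
  · simp
  have h1 : (m : ℝ) < (7 + Real.sqrt (72 * (q : ℝ) ^ 2 + 121)) / 18 := Nat.lt_ceil.1 hm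
  have hm1 : (1 : ℝ) ≤ m := by exact_mod_cast hm0
  have h2 : 18 * (m : ℝ) - 7 < Real.sqrt (72 * (q : ℝ) ^ 2 + 121) := by linarith
  rw [Real.lt_sqrt (by linarith)] at h2
  obtain ⟨k, rfl⟩ : ∃ k, m = k + 1 := ⟨m - 1, by omega⟩
  have h3 : 2 * ((k + 1) * (k + 1 - 1) / 2) = (k + 1) * k :=
    Nat.mul_div_cancel' (by rw [mul_comm]; exact (Nat.even_mul_succ_self k).two_dvd)
  have h4 : 9 * ((k + 1) * k) + 2 * (k + 1) < 2 * q ^ 2 + 2 := by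
    have h5 : (9 * (((k : ℝ) + 1) * k) + 2 * (k + 1)) < 2 * (q : ℝ) ^ 2 + 2 := by
      push_cast at h2
      linarith
    exact_mod_cast h5
  omega

theorem three_le_ceil {q : ℕ} (hq : 4 ≤ q) :
    3 ≤ ⌈(7 + Real.sqrt (72 * (q : ℝ) ^ 2 + 121)) / 18⌉₊ := by
  refine Nat.succ_le_of_lt (Nat.lt_ceil.2 ?_)
  have hq' : (4 : ℝ) ≤ q := by exact_mod_cast hq
  have h : (29 : ℝ) < Real.sqrt (72 * (q : ℝ) ^ 2 + 121) := by
    rw [Real.lt_sqrt (by norm_num)]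
    nlinarith
  push_cast
  linarith

theorem tendsto_lrcLength_div :
    Tendsto (fun q : ℕ => (lrcLength q : ℝ) / (q : ℝ)) atTop (𝓝 (Real.sqrt 2)) := by
  have hinv : Tendsto (fun q : ℕ => ((q : ℝ))⁻¹) atTop (𝓝 0) := tendsto_inv_atTop_nhds_zero_nat
  have hlow : Tendsto (fun q : ℕ => (7 * (q : ℝ)⁻¹ + Real.sqrt (72 + 121 * (q : ℝ)⁻¹ ^ 2)) / 6)
      atTop (𝓝 (Real.sqrt 2)) := by
    have h72 : Real.sqrt 72 = 6 * Real.sqrt 2 := by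
      rw [show (72 : ℝ) = 6 ^ 2 * 2 by norm_num, Real.sqrt_mul (by norm_num),
        Real.sqrt_sq (by norm_num)]
    have h := ((hinv.const_mul 7).add
      (((hinv.pow 2).const_mul 121).const_add 72).sqrt).div_const 6
    convert h using 2
    norm_num [h72]
  have hup := hlow.add (hinv.const_mul 3)
  rw [mul_zero, add_zero] at hup
  have hroot : ∀ q : ℕ, 0 < q → Real.sqrt (72 * (q : ℝ) ^ 2 + 121) =
      q * Real.sqrt (72 + 121 * (q : ℝ)⁻¹ ^ 2) := fun q hq => by
    have hq' : (0 : ℝ) < q := by exact_mod_cast hq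
    rw [← Real.sqrt_sq hq'.le, ← Real.sqrt_mul (sq_nonneg _), Real.sqrt_sq hq'.le]
    congr 1
    field_simp
  refine tendsto_of_tendsto_of_tendsto_of_le_of_le' hlow hup ?_ ?_
  · filter_upwards [eventually_gt_atTop 0] with q hq
    have hq' : (0 : ℝ) < q := by exact_mod_cast hq
    have h := Nat.le_ceil ((7 + Real.sqrt (72 * (q : ℝ) ^ 2 + 121)) / 18)
    rw [le_div_iff₀ hq', lrcLength, Nat.cast_mul]
    rw [hroot q hq] at h ⊢
    have : 7 * (q : ℝ)⁻¹ * q = 7 := by field_simp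
    push_cast
    linarith
  · filter_upwards [eventually_gt_atTop 0] with q hq
    have hq' : (0 : ℝ) < q := by exact_mod_cast hq
    have h := Nat.ceil_lt_add_one
      (a := (7 + Real.sqrt (72 * (q : ℝ) ^ 2 + 121)) / 18) (by positivity)
    rw [div_le_iff₀ hq', lrcLength, Nat.cast_mul]
    rw [hroot q hq] at h ⊢
    have : 7 * (q : ℝ)⁻¹ * q = 7 := by field_simp
    have : 3 * (q : ℝ)⁻¹ * q = 3 := by field_simp
    push_cast
    linarith

/-! ### Existence -/

/-- The greedy step keeps the first three members of the family, and with them the two marked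
vectors whose sum lies in the third plane. -/
theorem exists_isMarkedFamily {F K : Type*} [Field F] [Fintype F] [Field K] [Fintype K]
    [Algebra F K] (hq : 4 ≤ Fintype.card F) (hK : Module.finrank F K = 2) {m : ℕ} (hm : 3 ≤ m)
    (hbound : ∀ l < m, 9 * (l * (l - 1) / 2) + l < Fintype.card F ^ 2 + 1) :
    ∃ (u : ℕ → Option K) (a b : ℕ → K × K), IsMarkedFamily (spread F K) m u a b ∧
      ∃ x y, IsMarked F (a 0) (b 0) x ∧ IsMarked F (a 1) (b 1) y ∧ x + y ∈ spread F K (u 2) := by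
  induction m, hm using Nat.le_induction with
  | base => exact exists_isMarkedFamily_three hq hK
  | succ m hm ih =>
    obtain ⟨u, a, b, h, x, y, hx, hy, hxy⟩ := ih fun l hl => hbound l (by omega)
    have hcard : Fintype.card (Option K) = Fintype.card F ^ 2 + 1 := by
      rw [Fintype.card_option, Module.card_eq_pow_finrank (K := F) (V := K), hK]
    obtain ⟨s, a', b', h'⟩ := h.exists_extend pairwise_disjoint_spread
      (fun s => by rw [finrank_spread, hK]) hcard (hbound m (by omega))
    refine ⟨_, _, _, h', x, y, ?_, ?_, ?_⟩
    · rwa [Function.update_of_ne (show 0 ≠ m by omega), Function.update_of_ne (show 0 ≠ m by omega)]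
    · rwa [Function.update_of_ne (show 1 ≠ m by omega), Function.update_of_ne (show 1 ≠ m by omega)]
    · rwa [Function.update_of_ne (show 2 ≠ m by omega)]

theorem mainTheorem7 :
    (∀ (q : ℕ) (F : Type*) [Field F] [Fintype F] [DecidableEq F],
      Fintype.card F = q → 4 ≤ q →
        ∃ C : Submodule F (Fin (lrcLength q) → F), IsSingletonOptimalLRC C 7 2) ∧
    Tendsto (fun q : ℕ => (lrcLength q : ℝ) / (q : ℝ)) atTop (𝓝 (Real.sqrt 2)) := by
  refine ⟨fun q F _ _ _ hF hq => ?_, tendsto_lrcLength_div⟩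
  subst hF
  have : Fact (ringChar F).Prime := ⟨CharP.char_is_prime F (ringChar F)⟩
  let K := FiniteField.Extension F (ringChar F) 2
  have hK : Module.finrank F K = 2 := FiniteField.finrank_extension F (ringChar F) 2
  let _ : Fintype K := Fintype.ofFinite K
  obtain ⟨u, a, b, h, x, y, hx, hy, hxy⟩ := exists_isMarkedFamily (K := K) hq hK
    (three_le_ceil hq) fun l hl => greedy_bound_of_lt_ceil hl
  have := Module.finite_of_finrank_pos (R := F) (M := K) (by omega)
  have hV : Module.finrank F (K × K) = 4 := by rw [Module.finrank_prod, hK]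
  exact ⟨_, h.isSingletonOptimalLRC pairwise_disjoint_spread
    (fun s => by rw [finrank_spread, hK]) hV (three_le_ceil hq) hx hy hxy⟩
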